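/- For a nonzero complex Banach space $X$, a continuous $k$-homogeneous polynomial on $X$ is a map $P(x)=T(x,\dots,x)$ with $T$ a continuous $k$-linear form on $X$, and $\|P\|=\sup_{\|z\|_X=1}|P(z)|$. For degrees $k_1,\dots,k_n$ let $M(X,k_1,\dots,k_n)$ be the largest $M$ such that $$\|P_1\cdots P_n\|\ \ge\ M\,\|P_1\|\cdots\|P_n\|$$ for all continuous homogeneous polynomials $P_1,\dots,P_n$ on $X$ of degrees $k_1,\dots,k_n$ respectively. Write $\ell_p^N=(\mathbb C^N,\|\cdot\|_p)$, let $L_p(\Omega,\mu)$ be the complex Lebesgue space, and put $1/\infty=0$. **Theorem.** Let $n\ge 1$, let $k_1,\dots,k_n\ge 0$ be integers, and let $2\le p\le\infty$. (a) For every $N\ge n$, $$M(\ell_2^N,k_1,\dots,k_n)\ \ge\ M(\ell_p^N,k_1,\dots,k_n)\ \ge\ \big(n^{k_1+\cdots+k_n}\big)^{\frac1p-\frac12}\,M(\ell_2^N,k_1,\dots,k_n).$$ (b) Let $(\Omega,\mu)$ be a measure space with $\Omega=A_1\cup\dots\cup A_n$, where the $A_i$ are measurable, $\mu(A_i)>0$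 for all $i$, and $\mu(A_i\cap A_j)=0$ for $i\ne j$. If $p<\infty$, assume also that every $A_i$ contains a measurable set of positive finite measure (which is automatic if $\mu$ is $\sigma$-finite). Then for every $N\ge n$, $$M(\ell_2^N,k_1,\dots,k_n)\ \ge\ M(L_p(\Omega,\mu),k_1,\dots,k_n)\ \ge\ \big(n^{k_1+\cdots+k_n}\big)^{\frac1p-\frac12}\,M(\ell_2^N,k_1,\dots,k_n).$$ If every $A_i$ contains a measurable set of positive finite measure (now also when $p=\infty$), the same two inequalities hold with $L_2(\Omega,\mu)$ in place of $\ell_2^N$. -/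

import Mathlib

open scoped ENNReal
open MeasureTheory

/-- `P : X → ℂ` is a continuous `k`-homogeneous polynomial: there is a continuous `k`-linear
form `T` with `P x = T (x, …, x)` for all `x`. -/
def IsHomPoly {X : Type*} [NormedAddCommGroup X] [NormedSpace ℂ X] (k : ℕ) (P : X → ℂ) : Prop :=
  ∃ T : ContinuousMultilinearMap ℂ (fun _ : Fin k => X) ℂ, ∀ x : X, P x = T (fun _ => x)

/-- The uniform norm `‖P‖ = sup_{‖z‖ = 1} |P z|` (used for homogeneous polynomials, which are
bounded on the unit sphere). -/
noncomputable def polyNorm {X : Type*} [NormedAddCommGroup X] (P : X → ℂ) : ℝ :=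
  ⨆ z : Metric.sphere (0 : X) 1, ‖P z‖

/-- The real numbers `M` for which `‖P₁ ⋯ Pₙ‖ ≥ M ‖P₁‖ ⋯ ‖Pₙ‖` for all continuous homogeneous
polynomials `P₁, …, Pₙ` on `X`, of degrees `k₁, …, kₙ` respectively. -/
def factorConstants (X : Type*) [NormedAddCommGroup X] [NormedSpace ℂ X] {n : ℕ}
    (k : Fin n → ℕ) : Set ℝ :=
  {M : ℝ | ∀ P : Fin n → X → ℂ, (∀ i, IsHomPoly (k i) (P i)) →
    polyNorm (fun x => ∏ i, P i x) ≥ M * ∏ i, polyNorm (P i)}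

/-- The optimal constant `M(X, k₁, …, kₙ)`. It is the largest element of `factorConstants X k`
when `X ≠ 0`, see `isGreatest_optimalConst`. -/
noncomputable def optimalConst (X : Type*) [NormedAddCommGroup X] [NormedSpace ℂ X] {n : ℕ}
    (k : Fin n → ℕ) : ℝ :=
  sSup (factorConstants X k)

/-- `Ω = A₁ ⊔ ⋯ ⊔ Aₙ`: the measurable sets `Aᵢ` cover `Ω`, have positive measure, and
intersect pairwise in null sets. -/
structure IsDecomposition {Ω : Type*} [MeasurableSpace Ω] (μ : Measure Ω) {n : ℕ}
    (A : Fin n → Set Ω) : Prop where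
  measurable : ∀ i, MeasurableSet (A i)
  cover : ⋃ i, A i = Set.univ
  pos : ∀ i, 0 < μ (A i)
  inter_null : ∀ i j, i ≠ j → μ (A i ∩ A j) = 0

/-- Every `Aᵢ` has a measurable subset of positive finite measure. For sets of positive measure
this is automatic if `μ` is `σ`-finite, or just semifinite. -/
def HasFiniteParts {Ω : Type*} [MeasurableSpace Ω] (μ : Measure Ω) {n : ℕ}
    (A : Fin n → Set Ω) : Prop :=
  ∀ i, ∃ B ⊆ A i, MeasurableSet B ∧ 0 < μ B ∧ μ B < ∞

theorem IsHomPoly.exists_bound {X : Type*} [NormedAddCommGroup X] [NormedSpace ℂ X] {k : ℕ}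
    {P : X → ℂ} (h : IsHomPoly k P) : ∃ C : ℝ, ∀ z : Metric.sphere (0 : X) 1, ‖P z‖ ≤ C := by
  obtain ⟨T, hT⟩ := h
  refine ⟨‖T‖, fun z => ?_⟩
  have hz : ‖(z : X)‖ = 1 := by simp
  rw [hT]
  simpa [hz] using T.le_opNorm (fun _ => (z : X))

theorem polyNorm_nonneg {X : Type*} [NormedAddCommGroup X] (P : X → ℂ) : 0 ≤ polyNorm P :=
  Real.iSup_nonneg fun _ => norm_nonneg _

theorem isHomPoly_pow {X : Type*} [NormedAddCommGroup X] [NormedSpace ℂ X] (f : X →L[ℂ] ℂ)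
    (k : ℕ) : IsHomPoly k (fun x => f x ^ k) :=
  ⟨(ContinuousMultilinearMap.mkPiAlgebraFin ℂ k ℂ).compContinuousLinearMap (fun _ => f),
    fun x => by simp⟩

theorem isGreatest_optimalConst (X : Type*) [NormedAddCommGroup X] [NormedSpace ℂ X]
    [Nontrivial X] {n : ℕ} (k : Fin n → ℕ) :
    IsGreatest (factorConstants X k) (optimalConst X k) := by
  have hne : (factorConstants X k).Nonempty := ⟨0, fun P _ => by
    simpa using polyNorm_nonneg _⟩
  have key : ∀ M ∈ factorConstants X k, ∀ P : Fin n → X → ℂ, (∀ i, IsHomPoly (k i) (P i)) →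
      0 < ∏ i, polyNorm (P i) →
      M ≤ polyNorm (fun x => ∏ i, P i x) / ∏ i, polyNorm (P i) := fun M hM P hP hc =>
    (le_div_iff₀ hc).2 (hM P hP)
  have hbdd : BddAbove (factorConstants X k) := by
    obtain ⟨x, hx⟩ := NormedSpace.exists_lt_norm ℂ X 0
    obtain ⟨y, hy⟩ : ∃ y : X, ‖y‖ = 1 := ⟨((‖x‖ : ℂ)⁻¹) • x, by
      rw [norm_smul]; simp [hx.ne']⟩
    obtain ⟨f, -, hf⟩ := exists_dual_vector ℂ y (by intro h; simp [h] at hy)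
    refine ⟨_, fun M hM => key M hM (fun i x => f x ^ k i) (fun i => isHomPoly_pow f (k i)) ?_⟩
    refine Finset.prod_pos fun i _ => ?_
    obtain ⟨C, hC⟩ := (isHomPoly_pow f (k i)).exists_bound
    have h1 : ‖f y ^ k i‖ ≤ polyNorm (fun x => f x ^ k i) :=
      le_ciSup (f := fun z : Metric.sphere (0 : X) 1 => ‖f z ^ k i‖)
        ⟨C, by rintro _ ⟨z, rfl⟩; exact hC z⟩ ⟨y, by simp [hy]⟩
    refine lt_of_lt_of_le ?_ h1
    simp [hf, hy]
  refine ⟨fun P hP => ?_, fun M hM => le_csSup hbdd hM⟩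
  rcases (Finset.prod_nonneg fun i (_ : i ∈ Finset.univ) =>
    polyNorm_nonneg (P i)).eq_or_lt with h | h
  · rw [← h, mul_zero]
    exact polyNorm_nonneg _
  · exact (le_div_iff₀ h).1 (csSup_le hne fun M hM => key M hM P hP h)

/-! Put K = ∑ kᵢ and H = `hilbertConst k`. For X = ℓ_p^N or L_p(Ω, μ) the proof gives n^(K(1/p -
1/2)) H ≤ M(X) ≤ H. At p = 2 the two bounds coincide, so M = H on the Hilbert spaces, and all the
comparisons follow.

Lower bound (`HasHadamardType.prod_norm_le`). For unit vectors xᵢ put yᵢ = √(kᵢ/K) xᵢ and z_s = ∑ⱼ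
U_sj wⱼ yⱼ, with U the Fourier matrix and |wⱼ| = 1. The torus maximum principle
`exists_torus_prod_le`, applied to Gᵢ(w) = ∏_s Pᵢ(z_s), yields a w with ∏ᵢ |Pᵢ(yᵢ)|ⁿ ≤ ∏_s ∏ᵢ
|Pᵢ(z_s)| ≤ ‖∏ Pᵢ‖ⁿ (∏_s ‖z_s‖)^K. In L_p one has ∏_s ‖z_s‖ ≤ Dⁿ with D = n^(1/2 - 1/p): this
combines the ℓ₂ → ℓ_p bound for U, Minkowski's inequality in L_{p/2} and AM-GM.

Upper bound (`optimalConst_le_hilbertConst_of_retract`). X retracts onto a copy of ℓ_pⁿ without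
increasing norms. The rescaled rows of U give norm-one functionals φᵢ with ∑ |φᵢ x|² ≤ ‖x‖², and the
polynomials φᵢ^kᵢ show M ≤ H by weighted AM-GM. -/

/-! ### Complex Hadamard matrices -/

/-- A complex Hadamard matrix: its entries are unimodular, and it multiplies Euclidean norms
by `√n`. -/
structure IsComplexHadamard {n : ℕ} (U : Fin n → Fin n → ℂ) : Prop where
  norm_apply : ∀ s j, ‖U s j‖ = 1
  sum_sq : ∀ c : Fin n → ℂ, ∑ s, ‖∑ j, U s j * c j‖ ^ 2 = n * ∑ j, ‖c j‖ ^ 2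

theorem IsPrimitiveRoot.sum_pow_mul_conj {n : ℕ} {ζ : ℂ} (hζ : IsPrimitiveRoot ζ n)
    (hn : n ≠ 0) (i j : Fin n) :
    ∑ s : Fin n, ζ ^ (s * i : ℕ) * (starRingEnd ℂ) (ζ ^ (s * j : ℕ)) =
      if i = j then (n : ℂ) else 0 := by
  have hnorm : ‖ζ‖ = 1 := hζ.norm'_eq_one hn
  have h0 : ζ ≠ 0 := by rintro rfl; simp at hnorm
  have hconj : (starRingEnd ℂ) ζ = ζ⁻¹ := (Complex.inv_eq_conj hnorm).symm
  have hterm : ∀ s : Fin n, ζ ^ (s * i : ℕ) * (starRingEnd ℂ) (ζ ^ (s * j : ℕ)) =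
      (ζ ^ (i : ℕ) * (ζ ^ (j : ℕ))⁻¹) ^ (s : ℕ) := fun s => by
    rw [map_pow, hconj, mul_pow, inv_pow, inv_pow, ← pow_mul, ← pow_mul, mul_comm (s : ℕ) i,
      mul_comm (s : ℕ) j]
  simp_rw [hterm]
  split_ifs with h
  · subst h
    simp [h0]
  · rw [Fin.sum_univ_eq_sum_range (fun s => (ζ ^ (i : ℕ) * (ζ ^ (j : ℕ))⁻¹) ^ s) n]
    have hne : ζ ^ (i : ℕ) * (ζ ^ (j : ℕ))⁻¹ ≠ 1 := by
      intro h1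
      refine h (Fin.ext (hζ.pow_inj i.2 j.2 ?_))
      rwa [← div_eq_mul_inv, div_eq_one_iff_eq (pow_ne_zero _ h0)] at h1
    rw [geom_sum_eq hne, mul_pow, inv_pow, ← pow_mul, ← pow_mul, mul_comm (i : ℕ), mul_comm (j : ℕ),
      pow_mul, pow_mul, hζ.pow_eq_one]
    simp

theorem exists_isComplexHadamard {n : ℕ} (hn : n ≠ 0) :
    ∃ U : Fin n → Fin n → ℂ, IsComplexHadamard U := by
  have hζ := Complex.isPrimitiveRoot_exp n hn
  set ζ := Complex.exp (2 * Real.pi * Complex.I / n)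
  refine ⟨fun s j => ζ ^ (s * j : ℕ), fun s j => by simp [hζ.norm'_eq_one hn], fun c => ?_⟩
  apply Complex.ofReal_injective
  push_cast
  have key : ∀ z : ℂ, (‖z‖ : ℂ) ^ 2 = z * (starRingEnd ℂ) z := fun z => (Complex.mul_conj' z).symm
  simp_rw [key, map_sum, Finset.sum_mul_sum]
  rw [Finset.sum_comm, Finset.mul_sum]
  refine Finset.sum_congr rfl fun i _ => ?_
  rw [Finset.sum_comm]
  have : ∀ j : Fin n, ∑ s : Fin n, ζ ^ (s * i : ℕ) * c i *
      (starRingEnd ℂ) (ζ ^ (s * j : ℕ) * c j) =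
      c i * (starRingEnd ℂ) (c j) * if i = j then (n : ℂ) else 0 := fun j => by
    rw [← hζ.sum_pow_mul_conj hn i j, Finset.mul_sum]
    exact Finset.sum_congr rfl fun s _ => by rw [map_mul]; ring
  simp_rw [this]
  simp [mul_comm]

/-! ### Maximum principle on the torus -/

theorem Complex.exists_norm_eq_one_norm_le {f : ℂ → ℂ} (hf : Differentiable ℂ f) :
    ∃ t : ℂ, ‖t‖ = 1 ∧ ‖f 0‖ ≤ ‖f t‖ := by
  obtain ⟨t, ht, hmax⟩ := Complex.exists_mem_frontier_isMaxOn_norm (f := f)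
    (Metric.isBounded_ball (x := (0 : ℂ)) (r := 1)) ⟨0, by simp⟩ hf.diffContOnCl
  rw [frontier_ball _ one_ne_zero] at ht
  exact ⟨t, by simpa using ht, hmax (subset_closure (by simp))⟩

/-- A maximum principle on the torus: for entire homogeneous functions `Gᵢ`
on `ℂⁿ`, the product `∏ |Gᵢ|` exceeds `∏ |Gᵢ(eᵢ)|` somewhere on the torus. -/
theorem exists_torus_prod_le {ι : Type*} [Fintype ι] [DecidableEq ι] {d : ι → ℕ}
    {G : ι → (ι → ℂ) → ℂ} (hG : ∀ i, Differentiable ℂ (G i))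
    (hom : ∀ i (t : ℂ) w, G i (t • w) = t ^ d i * G i w) :
    ∃ w : ι → ℂ, (∀ j, ‖w j‖ = 1) ∧ ∏ i, ‖G i (Pi.single i 1)‖ ≤ ∏ i, ‖G i w‖ := by
  suffices H : ∀ s : Finset ι, ∃ w : ι → ℂ, (∀ j ∈ s, ‖w j‖ = 1) ∧ (∀ j ∉ s, w j = 0) ∧
      ∏ i ∈ s, ‖G i (Pi.single i 1)‖ ≤ ∏ i ∈ s, ‖G i w‖ by
    obtain ⟨w, h1, -, h2⟩ := H Finset.univ
    exact ⟨w, fun j => h1 j (Finset.mem_univ j), h2⟩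
  intro s
  induction s using Finset.induction_on with
  | empty => exact ⟨0, by simp⟩
  | insert a s ha ih =>
    obtain ⟨w, h1, h0, hw⟩ := ih
    set e : ι → ℂ := Pi.single a 1 with he
    let g : ℂ → ℂ := fun t => ∏ i ∈ s, G i (w + t • e)
    have hg : Differentiable ℂ g := by
      refine Differentiable.fun_finsetProd fun i _ => (hG i).comp ?_
      fun_prop
    have hg' : Differentiable ℂ ((starRingEnd ℂ) ∘ g ∘ (starRingEnd ℂ)) := fun z => by
      simpa using (hg ((starRingEnd ℂ) z)).conj_conj
    -- For |t| = 1, homogeneity gives |G a (e + t • w)| = |G a (w + t⁻¹ • e)|, and t⁻¹ is the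
    -- conjugate of t. Conjugating g inside and outside keeps it entire and evaluates it at the same
    -- point w + t⁻¹ • e.
    have hf : Differentiable ℂ
        (fun t => G a (e + t • w) * ((starRingEnd ℂ) ∘ g ∘ (starRingEnd ℂ)) t) := by
      refine Differentiable.mul ((hG a).comp ?_) hg'
      fun_prop
    obtain ⟨t, ht, hle⟩ := Complex.exists_norm_eq_one_norm_le hf
    set u := (starRingEnd ℂ) t with hu
    have htu : t * u = 1 := by rw [hu, Complex.mul_conj']; simp [ht]
    have hun : ‖u‖ = 1 := by simpa [hu] using ht
    refine ⟨w + u • e, fun j hj => ?_, fun j hj => ?_, ?_⟩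
    · rcases Finset.mem_insert.1 hj with rfl | hj
      · simp [he, h0 _ ha, hun]
      · have : j ≠ a := fun h => ha (h ▸ hj)
        simp [he, this, h1 j hj]
    · rw [Finset.mem_insert, not_or] at hj
      simp [he, hj.1, h0 j hj.2]
    · have h2 : e + t • w = t • (w + u • e) := by
        rw [smul_add, smul_smul, htu, one_smul, add_comm]
      have h3 : ‖G a (e + t • w)‖ = ‖G a (w + u • e)‖ := by
        rw [h2, hom]; simp [ht]
      rw [Finset.prod_insert ha, Finset.prod_insert ha]
      simp only [norm_mul, h3, Function.comp, RCLike.norm_conj, zero_smul, add_zero, map_zero,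
        g, norm_prod] at hle
      exact (mul_le_mul_of_nonneg_left hw (norm_nonneg _)).trans hle

/-! ### Homogeneous polynomials and their norms -/

theorem norm_le_polyNorm_of_bound {X : Type*} [NormedAddCommGroup X] {P : X → ℂ} {C : ℝ}
    (hC : ∀ z : X, ‖z‖ = 1 → ‖P z‖ ≤ C)
    {z : X} (hz : ‖z‖ = 1) : ‖P z‖ ≤ polyNorm P :=
  le_ciSup (f := fun z : Metric.sphere (0 : X) 1 => ‖P z‖)
    ⟨C, by rintro _ ⟨y, rfl⟩; exact hC y (by simp)⟩ ⟨z, by simp [hz]⟩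

section HomPoly

variable {X : Type*} [NormedAddCommGroup X] [NormedSpace ℂ X]

theorem IsHomPoly.map_smul {m : ℕ} {P : X → ℂ} (h : IsHomPoly m P) (t : ℂ) (x : X) :
    P (t • x) = t ^ m * P x := by
  obtain ⟨T, hT⟩ := h
  rw [hT, hT]
  simpa using T.map_smul_univ (fun _ => t) (fun _ => x)

theorem IsHomPoly.differentiable {m : ℕ} {P : X → ℂ} (h : IsHomPoly m P) :
    Differentiable ℂ P := by
  obtain ⟨T, hT⟩ := h
  have : P = fun x => T (fun _ => x) := funext hT
  rw [this]
  exact (T.contDiff (n := 1)).differentiable (by simp) |>.comp (by fun_prop)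

theorem IsHomPoly.norm_le_polyNorm {m : ℕ} {P : X → ℂ} (h : IsHomPoly m P) {z : X}
    (hz : ‖z‖ = 1) : ‖P z‖ ≤ polyNorm P := by
  obtain ⟨C, hC⟩ := h.exists_bound
  exact norm_le_polyNorm_of_bound (fun z hz => hC ⟨z, by simp [hz]⟩) hz

theorem norm_prod_le_polyNorm {n : ℕ} {k : Fin n → ℕ} {P : Fin n → X → ℂ}
    (hP : ∀ i, IsHomPoly (k i) (P i)) {z : X} (hz : ‖z‖ = 1) :
    ‖∏ i, P i z‖ ≤ polyNorm (fun x => ∏ i, P i x) := by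
  refine norm_le_polyNorm_of_bound (P := fun x => ∏ i, P i x) (C := ∏ i, polyNorm (P i))
    (fun y hy => ?_) hz
  rw [norm_prod]
  exact Finset.prod_le_prod (fun _ _ => norm_nonneg _) fun i _ => (hP i).norm_le_polyNorm hy

theorem exists_unit_smul_eq [Nontrivial X] (z : X) :
    ∃ u : X, ‖u‖ = 1 ∧ z = (‖z‖ : ℂ) • u := by
  rcases eq_or_ne z 0 with rfl | hz
  · obtain ⟨y, hy⟩ := exists_ne (0 : X)
    exact ⟨((‖y‖ : ℂ)⁻¹) • y, by rw [norm_smul]; simp [hy], by simp⟩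
  · have h : (‖z‖ : ℂ) ≠ 0 := by simpa using hz
    exact ⟨((‖z‖ : ℂ)⁻¹) • z, by rw [norm_smul]; simp [hz],
      by rw [smul_smul, mul_inv_cancel₀ h, one_smul]⟩

theorem norm_prod_le_polyNorm_mul [Nontrivial X] {n : ℕ} {k : Fin n → ℕ} {P : Fin n → X → ℂ}
    (hP : ∀ i, IsHomPoly (k i) (P i)) (z : X) :
    ‖∏ i, P i z‖ ≤ polyNorm (fun x => ∏ i, P i x) * ‖z‖ ^ (∑ i, k i) := by
  obtain ⟨u, hu, hz⟩ := exists_unit_smul_eq z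
  have h1 : ∏ i, P i z = (‖z‖ : ℂ) ^ (∑ i, k i) * ∏ i, P i u := by
    conv_lhs => rw [hz]
    simp_rw [fun i => (hP i).map_smul, Finset.prod_mul_distrib, Finset.prod_pow_eq_pow_sum]
  rw [h1, norm_mul, mul_comm, norm_pow, Complex.norm_real, norm_norm]
  exact mul_le_mul_of_nonneg_right (norm_prod_le_polyNorm hP hu) (by positivity)

end HomPoly

/-! ### The lower bound -/

/-- The constant `∏ᵢ (kᵢ / K) ^ (kᵢ / 2)`, `K = ∑ᵢ kᵢ`, of products on Hilbert spaces. -/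
noncomputable def hilbertConst {n : ℕ} (k : Fin n → ℕ) : ℝ :=
  ∏ i, √((k i : ℝ) / ((∑ j, k j : ℕ) : ℝ)) ^ k i

theorem hilbertConst_nonneg {n : ℕ} (k : Fin n → ℕ) : 0 ≤ hilbertConst k :=
  Finset.prod_nonneg fun _ _ => by positivity

/-- Equality fails only when all degrees vanish: then 0 / 0 = 0 makes the sum 0. -/
theorem sum_div_sum_le_one {n : ℕ} (k : Fin n → ℕ) :
    ∑ i, (k i : ℝ) / ((∑ j, k j : ℕ) : ℝ) ≤ 1 := by
  rw [← Finset.sum_div]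
  push_cast
  exact div_self_le_one _

/-- A multiplicative type-two inequality for the Hadamard matrix `U`. -/
def HasHadamardType {n : ℕ} (U : Fin n → Fin n → ℂ) (D : ℝ) (X : Type*) [NormedAddCommGroup X]
    [NormedSpace ℂ X] : Prop :=
  ∀ y : Fin n → X, ∏ s, ‖∑ j, U s j • y j‖ ≤ (D * √(∑ j, ‖y j‖ ^ 2)) ^ n

theorem Differentiable.finsetProd_of_normedSpace {E ι : Type*} [NormedAddCommGroup E]
    [NormedSpace ℂ E] {f : ι → E → ℂ} (s : Finset ι) (hf : ∀ i, Differentiable ℂ (f i)) :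
    Differentiable ℂ (fun x => ∏ i ∈ s, f i x) := by
  classical
  induction s using Finset.induction_on with
  | empty => simp
  | insert a s ha ih =>
    simp_rw [Finset.prod_insert ha]
    exact (hf a).mul ih

section Lower

variable {X : Type*} [NormedAddCommGroup X] [NormedSpace ℂ X]

theorem HasHadamardType.prod_norm_le [Nontrivial X] {n : ℕ} (hn : n ≠ 0) {U : Fin n → Fin n → ℂ}
    (hU : IsComplexHadamard U) {D : ℝ} (hD : 0 ≤ D) (h : HasHadamardType U D X) {k : Fin n → ℕ}
    {P : Fin n → X → ℂ} (hP : ∀ i, IsHomPoly (k i) (P i)) {y : Fin n → X}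
    (hy : ∑ j, ‖y j‖ ^ 2 ≤ 1) :
    ∏ i, ‖P i (y i)‖ ≤ D ^ (∑ i, k i) * polyNorm (fun x => ∏ i, P i x) := by
  set K := ∑ i, k i
  set Q := polyNorm (fun x => ∏ i, P i x)
  have hQ : 0 ≤ Q := polyNorm_nonneg _
  -- At the i-th basis vector only the unimodular multiples U s i • y i remain, so |G i| equals |P i
  -- (y i)|ⁿ there.
  let G : Fin n → (Fin n → ℂ) → ℂ := fun i w => ∏ s, P i (∑ j, U s j • w j • y j)
  have hG : ∀ i, Differentiable ℂ (G i) := fun i => by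
    have hlin : ∀ s, Differentiable ℂ (fun w : Fin n → ℂ => ∑ j, U s j • w j • y j) := fun s => by
      fun_prop
    exact Differentiable.finsetProd_of_normedSpace Finset.univ
      fun s => (hP i).differentiable.comp (hlin s)
  have hom : ∀ i (t : ℂ) w, G i (t • w) = t ^ (k i * n) * G i w := fun i t w => by
    have : ∀ s, ∑ j, U s j • (t • w) j • y j = t • ∑ j, U s j • w j • y j := fun s => by
      rw [Finset.smul_sum]
      refine Finset.sum_congr rfl fun j _ => ?_
      simp only [Pi.smul_apply, smul_smul, smul_eq_mul]
      congr 1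
      ring
    simp only [G, this, (hP i).map_smul, Finset.prod_mul_distrib]
    simp [pow_mul]
  obtain ⟨w, hw, hle⟩ := exists_torus_prod_le hG hom
  have hsingle : ∀ i, ‖G i (Pi.single i 1)‖ = ‖P i (y i)‖ ^ n := fun i => by
    have : ∀ s, ∑ j, U s j • (Pi.single i 1 : Fin n → ℂ) j • y j = U s i • y i := fun s => by
      rw [Finset.sum_eq_single i] <;> simp +contextual
    simp only [G, this, (hP i).map_smul, norm_prod, norm_mul, norm_pow, hU.norm_apply]
    simp
  simp_rw [hsingle, Finset.prod_pow] at hle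
  have hz : ∏ s, ‖∑ j, U s j • w j • y j‖ ≤ D ^ n := by
    refine (h fun j => w j • y j).trans (pow_le_pow_left₀ (by positivity) ?_ n)
    refine mul_le_of_le_one_right hD (Real.sqrt_le_one.2 ?_)
    simpa [norm_smul, hw] using hy
  refine le_of_pow_le_pow_left₀ hn (by positivity) (hle.trans ?_)
  -- Exchanging the products puts all the P i at one common point, where the norm of their product
  -- applies.
  calc ∏ i, ‖G i w‖ = ∏ s, ‖∏ i, P i (∑ j, U s j • w j • y j)‖ := by
        simp only [G, norm_prod]
        exact Finset.prod_comm
    _ ≤ ∏ s, (Q * ‖∑ j, U s j • w j • y j‖ ^ K) :=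
        Finset.prod_le_prod (fun _ _ => norm_nonneg _) fun s _ => norm_prod_le_polyNorm_mul hP _
    _ = Q ^ n * (∏ s, ‖∑ j, U s j • w j • y j‖) ^ K := by
        rw [Finset.prod_mul_distrib, Finset.prod_pow]; simp
    _ ≤ Q ^ n * (D ^ n) ^ K := by gcongr
    _ = (D ^ K * Q) ^ n := by rw [mul_pow, ← pow_mul, ← pow_mul, mul_comm n K, mul_comm]

/-- The suprema need not be attained, so each norm is approached within a factor c < 1, and c then
tends to 1. -/
theorem mul_prod_polyNorm_le [Nontrivial X] {n : ℕ} {P : Fin n → X → ℂ} {a b : ℝ}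
    (h : ∀ x : Fin n → X, (∀ i, ‖x i‖ = 1) → a * ∏ i, ‖P i (x i)‖ ≤ b) (ha : 0 ≤ a) (hb : 0 ≤ b) :
    a * ∏ i, polyNorm (P i) ≤ b := by
  by_cases hpos : ∀ i, 0 < polyNorm (P i)
  · have key : ∀ c ∈ Set.Ioo (0 : ℝ) 1, a * ∏ i, (c * polyNorm (P i)) ≤ b := fun c hc => by
      have : ∀ i, ∃ x : X, ‖x‖ = 1 ∧ c * polyNorm (P i) ≤ ‖P i x‖ := fun i => by
        obtain ⟨u, hu, -⟩ := exists_unit_smul_eq (0 : X)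
        have : Nonempty (Metric.sphere (0 : X) 1) := ⟨⟨u, by simp [hu]⟩⟩
        obtain ⟨x, hx⟩ := exists_lt_of_lt_ciSup (f := fun z : Metric.sphere (0 : X) 1 => ‖P i z‖)
          (b := c * polyNorm (P i)) (mul_lt_of_lt_one_left (hpos i) hc.2)
        exact ⟨x, by simp, hx.le⟩
      choose x hx1 hx using this
      refine le_trans ?_ (h x hx1)
      gcongr with i
      · exact fun i _ => mul_nonneg hc.1.le (hpos i).le
      · exact hx i
    have hcont : Filter.Tendsto (fun c : ℝ => a * ∏ i, (c * polyNorm (P i)))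
        (nhdsWithin 1 (Set.Iio 1)) (nhds (a * ∏ i, (1 * polyNorm (P i)))) := by
      refine Filter.Tendsto.mono_left ?_ nhdsWithin_le_nhds
      exact Continuous.tendsto (by fun_prop) 1
    simp_rw [one_mul] at hcont
    exact le_of_tendsto hcont (Filter.eventually_of_mem (Ioo_mem_nhdsLT zero_lt_one) key)
  · push Not at hpos
    obtain ⟨i, hi⟩ := hpos
    rw [Finset.prod_eq_zero (Finset.mem_univ i) (le_antisymm hi (polyNorm_nonneg _)), mul_zero]
    exact hb

/-- The lower bound for products of homogeneous polynomials on a space of Hadamard type. -/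
theorem HasHadamardType.le_optimalConst [Nontrivial X] {n : ℕ} (hn : n ≠ 0)
    {U : Fin n → Fin n → ℂ} (hU : IsComplexHadamard U) {D : ℝ} (hD : 0 < D)
    (h : HasHadamardType U D X) (k : Fin n → ℕ) :
    (D ^ (∑ i, k i))⁻¹ * hilbertConst k ≤ optimalConst X k := by
  refine (isGreatest_optimalConst X k).2 fun P hP => ?_
  refine mul_prod_polyNorm_le (fun x hx => ?_)
    (mul_nonneg (by positivity) (hilbertConst_nonneg k)) (polyNorm_nonneg _)
  rw [mul_assoc, inv_mul_le_iff₀ (by positivity)]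
  -- These weights maximize ∏ aᵢ^kᵢ subject to ∑ aᵢ² ≤ 1, with maximum `hilbertConst k`.
  set a : Fin n → ℝ := fun i => √((k i : ℝ) / ((∑ j, k j : ℕ) : ℝ))
  have ha : ∀ i, 0 ≤ a i := fun i => Real.sqrt_nonneg _
  have := h.prod_norm_le hn hU hD.le hP (y := fun j => (a j : ℂ) • x j) (by
    refine le_trans (le_of_eq ?_) (sum_div_sum_le_one k)
    refine Finset.sum_congr rfl fun j _ => ?_
    rw [norm_smul, hx, mul_one, Complex.norm_real, Real.norm_eq_abs, sq_abs]
    exact Real.sq_sqrt (by positivity))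
  simp_rw [fun i => (hP i).map_smul, norm_mul, norm_pow, Complex.norm_real, Real.norm_eq_abs,
    abs_of_nonneg (ha _), Finset.prod_mul_distrib] at this
  exact this

end Lower

/-! ### The upper bound -/

theorem prod_pow_le_of_sum_le_one {n : ℕ} (k : Fin n → ℕ) {t : Fin n → ℝ} (ht : ∀ i, 0 ≤ t i)
    (hsum : ∑ i, t i ≤ 1) :
    ∏ i, t i ^ k i ≤ ∏ i, ((k i : ℝ) / ((∑ j, k j : ℕ) : ℝ)) ^ k i := by
  set K := ∑ j, k j
  rcases Nat.eq_zero_or_pos K with hK | hK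
  · have : ∀ i, k i = 0 := fun i => by simpa using (Finset.sum_eq_zero_iff.1 hK) i
    simp [this]
  have hK' : (0 : ℝ) < K := by exact_mod_cast hK
  -- Weighted AM-GM with weights kᵢ/K bounds the product of these by ∑ tᵢ. If kᵢ = 0, division by
  -- zero gives zᵢ = 0, which is harmless since zᵢ has exponent 0.
  set z : Fin n → ℝ := fun i => t i * (K / k i)
  have hz : ∀ i, 0 ≤ z i := fun i => mul_nonneg (ht i) (by positivity)
  have h1 : ∏ i, z i ^ ((k i : ℝ) / K) ≤ 1 := by
    refine (Real.geom_mean_le_arith_mean_weighted Finset.univ (fun i => (k i : ℝ) / K) z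
      (fun i _ => by positivity) ?_ (fun i _ => hz i)).trans (le_trans ?_ hsum)
    · rw [← Finset.sum_div, ← Nat.cast_sum]
      exact div_self hK'.ne'
    · refine Finset.sum_le_sum fun i _ => ?_
      rcases Nat.eq_zero_or_pos (k i) with hi | hi
      · simp [hi, ht i]
      · have hi' : (0 : ℝ) < k i := by exact_mod_cast hi
        simp only [z]
        exact le_of_eq (by field_simp)
  have h2 : ∏ i, z i ^ k i ≤ 1 := by
    have h3 := pow_le_one₀ (n := K)
      (Finset.prod_nonneg fun i _ => Real.rpow_nonneg (hz i) _) h1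
    rw [← Finset.prod_pow] at h3
    refine le_trans (le_of_eq (Finset.prod_congr rfl fun i _ => ?_)) h3
    rw [← Real.rpow_mul_natCast (hz i), div_mul_cancel₀ _ hK'.ne', Real.rpow_natCast]
  calc ∏ i, t i ^ k i = (∏ i, ((k i : ℝ) / K) ^ k i) * ∏ i, z i ^ k i := by
        rw [← Finset.prod_mul_distrib]
        refine Finset.prod_congr rfl fun i _ => ?_
        rcases Nat.eq_zero_or_pos (k i) with hi | hi
        · simp [hi]
        · have hi' : (0 : ℝ) < k i := by exact_mod_cast hi
          rw [← mul_pow]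
          simp only [z]
          congr 1
          field_simp
    _ ≤ _ := mul_le_of_le_one_right (Finset.prod_nonneg fun _ _ => by positivity) h2

theorem prod_pow_le_hilbertConst {n : ℕ} (k : Fin n → ℕ) {u : Fin n → ℝ}
    (hsum : ∑ i, u i ^ 2 ≤ 1) : ∏ i, u i ^ k i ≤ hilbertConst k := by
  refine le_of_pow_le_pow_left₀ two_ne_zero (hilbertConst_nonneg k) ?_
  have h := prod_pow_le_of_sum_le_one k (fun i => sq_nonneg (u i)) hsum
  rw [hilbertConst, ← Finset.prod_pow, ← Finset.prod_pow]
  refine le_trans (le_of_eq (Finset.prod_congr rfl fun i _ => ?_))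
    (h.trans (le_of_eq (Finset.prod_congr rfl fun i _ => ?_)))
  · rw [← pow_mul, ← pow_mul, mul_comm]
  · rw [← pow_mul, mul_comm, pow_mul, Real.sq_sqrt (by positivity)]

/-- The upper bound for products of powers of a square-summable system of norm-one functionals. -/
theorem optimalConst_le_hilbertConst {X : Type*} [NormedAddCommGroup X] [NormedSpace ℂ X]
    [Nontrivial X] {n : ℕ} (k : Fin n → ℕ) (φ : Fin n → X →L[ℂ] ℂ)
    (hφ : ∀ x, ∑ i, ‖φ i x‖ ^ 2 ≤ ‖x‖ ^ 2) (h1 : ∀ i, ∃ x, ‖x‖ ≤ 1 ∧ 1 ≤ ‖φ i x‖) :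
    optimalConst X k ≤ hilbertConst k := by
  have hmem := (isGreatest_optimalConst X k).1
  have h0 : 0 ≤ optimalConst X k := (isGreatest_optimalConst X k).2 fun P _ => by
    simpa using polyNorm_nonneg _
  have hP := hmem (fun i x => φ i x ^ k i) fun i => isHomPoly_pow (φ i) (k i)
  have hge : 1 ≤ ∏ i, polyNorm (fun x => φ i x ^ k i) := by
    refine Finset.one_le_prod fun i _ => ?_
    obtain ⟨x, hx, hx1⟩ := h1 i
    -- The square-sum bound gives |φᵢ x| ≤ ‖x‖, so x lies on the sphere over which `polyNorm` is
    -- taken.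
    have hx' : ‖x‖ = 1 := by
      refine le_antisymm hx ?_
      have h2 : ‖φ i x‖ ^ 2 ≤ ‖x‖ ^ 2 := le_trans
        (Finset.single_le_sum (f := fun i => ‖φ i x‖ ^ 2) (fun _ _ => by positivity)
          (Finset.mem_univ i)) (hφ x)
      exact hx1.trans (le_of_pow_le_pow_left₀ two_ne_zero (norm_nonneg _) h2)
    refine le_trans ?_ ((isHomPoly_pow (φ i) (k i)).norm_le_polyNorm hx')
    rw [norm_pow]
    exact one_le_pow₀ hx1
  refine (le_mul_of_one_le_right h0 hge).trans (hP.le.trans ?_)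
  refine Real.iSup_le (fun z => ?_) (hilbertConst_nonneg k)
  rw [norm_prod]
  simp_rw [norm_pow]
  refine prod_pow_le_hilbertConst k ((hφ z).trans ?_)
  simp

/-- This is the power-mean inequality with exponent p/2 for the numbers |cⱼ|²; at p = ∞ each term is
bounded separately. -/
theorem PiLp.sum_sq_norm_le {n : ℕ} {p : ℝ≥0∞} [Fact (1 ≤ p)] (hp : 2 ≤ p)
    (c : PiLp p (fun _ : Fin n => ℂ)) :
    ∑ j, ‖c j‖ ^ 2 ≤ (n : ℝ) ^ (1 - 2 * (1 / p).toReal) * ‖c‖ ^ 2 := by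
  rcases eq_or_ne p ∞ with rfl | hp'
  · refine (Finset.sum_le_card_nsmul _ _ (‖c‖ ^ 2) fun j _ => ?_).trans (by simp)
    gcongr
    exact PiLp.norm_apply_le c j
  · have hr : (2 : ℝ) ≤ p.toReal := by
      simpa using ENNReal.toReal_mono hp' hp
    set r := p.toReal
    have hr0 : 0 < r := by linarith
    have he : (1 / p).toReal = 1 / r := by simp [r]
    have hnorm : ‖c‖ ^ r = ∑ j, ‖c j‖ ^ r := by
      rw [PiLp.norm_eq_sum hr0, ← Real.rpow_mul (Finset.sum_nonneg fun _ _ => by positivity)]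
      simp [r, hr0.ne']
    have h := Real.rpow_sum_le_const_mul_sum_rpow_of_nonneg (s := Finset.univ)
      (f := fun j => ‖c j‖ ^ 2) (p := r / 2) (by linarith) (fun _ _ => by positivity)
    have h2 : ∀ x : ℝ, 0 ≤ x → (x ^ 2) ^ (r / 2) = x ^ r := fun x hx => by
      rw [← Real.rpow_natCast, ← Real.rpow_mul hx]; congr 1; push_cast; ring
    simp_rw [h2 _ (norm_nonneg _), ← hnorm] at h
    rw [← h2 _ (norm_nonneg c)] at h
    simp only [Finset.card_univ, Fintype.card_fin] at h
    have hexp : (n : ℝ) ^ (r / 2 - 1) = ((n : ℝ) ^ (1 - 2 * (1 / r))) ^ (r / 2) := by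
      rw [← Real.rpow_mul (by positivity)]; congr 1; field_simp
    rw [hexp, ← Real.mul_rpow (by positivity) (by positivity)] at h
    rw [he]
    exact (Real.rpow_le_rpow_iff (Finset.sum_nonneg fun _ _ => by positivity) (by positivity)
      (by positivity)).1 h

theorem PiLp.norm_le_one_of_norm_apply_eq {n : ℕ} {p : ℝ≥0∞} [Fact (1 ≤ p)]
    {c : PiLp p (fun _ : Fin n => ℂ)} (hc : ∀ j, ‖c j‖ = (n : ℝ) ^ (-(1 / p).toReal)) :
    ‖c‖ ≤ 1 := by
  rcases eq_or_ne p ∞ with rfl | hp'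
  · rw [PiLp.norm_eq_ciSup]
    exact Real.iSup_le (fun j => by simp [hc]) zero_le_one
  · have hr : 0 < p.toReal := ENNReal.toReal_pos (zero_lt_one.trans_le (Fact.out : 1 ≤ p)).ne' hp'
    rw [PiLp.norm_eq_sum hr]
    simp_rw [hc, ← Real.rpow_mul (Nat.cast_nonneg n)]
    refine Real.rpow_le_one (Finset.sum_nonneg fun _ _ => by positivity) ?_ (by positivity)
    have : -(1 / p).toReal * p.toReal = -1 := by simp [hr.ne']
    rw [this, Finset.sum_const, Finset.card_univ, Fintype.card_fin, nsmul_eq_mul, Real.rpow_neg_one]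
    exact mul_inv_le_one

theorem optimalConst_le_hilbertConst_of_retract {X : Type*} [NormedAddCommGroup X]
    [NormedSpace ℂ X] [Nontrivial X] {n : ℕ} (hn : n ≠ 0) (k : Fin n → ℕ) {p : ℝ≥0∞}
    [Fact (1 ≤ p)] (hp : 2 ≤ p) (T : Fin n → X →L[ℂ] ℂ)
    (hT : ∀ x, ‖(WithLp.toLp p (fun i => T i x) : PiLp p (fun _ : Fin n => ℂ))‖ ≤ ‖x‖)
    (J : PiLp p (fun _ : Fin n => ℂ) → X) (hJ : ∀ c, ‖J c‖ ≤ ‖c‖) (hTJ : ∀ c i, T i (J c) = c i) :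
    optimalConst X k ≤ hilbertConst k := by
  obtain ⟨U, hU⟩ := exists_isComplexHadamard hn
  have hn0 : (0 : ℝ) < n := by exact_mod_cast Nat.pos_of_ne_zero hn
  set e := (1 / p).toReal
  -- The scale satisfies a² · n · n^(1 - 2e) = 1, so the squares sum to at most ‖x‖². With b =
  -- n^(-e) below, a · n · b = 1, so each functional takes the value 1 at a vector of norm at most
  -- 1.
  set a : ℝ := (n : ℝ) ^ (e - 1)
  have ha : 0 ≤ a := by positivity
  have hval : ∀ i x, ((a : ℂ) • ∑ j, U i j • T j) x = a * ∑ j, U i j * T j x := fun i x => by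
    simp
  refine optimalConst_le_hilbertConst k (fun i => (a : ℂ) • ∑ j, U i j • T j) (fun x => ?_)
    fun i => ?_
  · simp_rw [hval, norm_mul, mul_pow, ← Finset.mul_sum, hU.sum_sq, Complex.norm_real,
      Real.norm_of_nonneg ha]
    have h := PiLp.sum_sq_norm_le hp (WithLp.toLp p (fun i => T i x) : PiLp p (fun _ : Fin n => ℂ))
    calc a ^ 2 * (n * ∑ j, ‖T j x‖ ^ 2)
        ≤ a ^ 2 * (n * ((n : ℝ) ^ (1 - 2 * e) * ‖x‖ ^ 2)) := by
          gcongr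
          refine h.trans ?_
          gcongr
          exact hT x
      _ = (a ^ 2 * n * (n : ℝ) ^ (1 - 2 * e)) * ‖x‖ ^ 2 := by ring
      _ = ‖x‖ ^ 2 := by
          have : a ^ 2 * n * (n : ℝ) ^ (1 - 2 * e) = 1 := by
            simp only [a]
            rw [← Real.rpow_natCast, ← Real.rpow_mul hn0.le, ← Real.rpow_add_one hn0.ne',
              ← Real.rpow_add hn0, ← Real.rpow_zero (n : ℝ)]
            congr 1; push_cast; ring
          rw [this, one_mul]
  · set b : ℝ := (n : ℝ) ^ (-e)
    have hb : 0 ≤ b := by positivity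
    -- Conjugating the row aligns the phases: all n terms of the i-th functional equal b.
    let c : PiLp p (fun _ : Fin n => ℂ) := WithLp.toLp p (fun j => b * (starRingEnd ℂ) (U i j))
    refine ⟨J c, (hJ c).trans (PiLp.norm_le_one_of_norm_apply_eq fun j => ?_), ?_⟩
    · change ‖(b : ℂ) * (starRingEnd ℂ) (U i j)‖ = b
      simp [hU.norm_apply, abs_of_nonneg hb]
    · rw [hval]
      have : ∀ j, U i j * T j (J c) = b := fun j => by
        rw [hTJ]
        change U i j * ((b : ℂ) * (starRingEnd ℂ) (U i j)) = b
        rw [mul_left_comm, Complex.mul_conj', hU.norm_apply]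
        simp
      simp_rw [this]
      have hab : a * (n * b) = 1 := by
        simp only [a, b]
        rw [mul_comm (n : ℝ), ← Real.rpow_add_one hn0.ne', ← Real.rpow_add hn0,
          ← Real.rpow_zero (n : ℝ)]
        congr 1; ring
      rw [Finset.sum_const, Finset.card_univ, Fintype.card_fin, nsmul_eq_mul]
      have h2 : (a : ℂ) * (n * b) = 1 := by exact_mod_cast hab
      rw [h2]; simp

/-! ### Hadamard type of L_p and ℓ_p -/

section HadamardType

variable {n : ℕ} {U : Fin n → Fin n → ℂ}

theorem IsComplexHadamard.norm_sum_smul_le (hU : IsComplexHadamard U) {X : Type*}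
    [NormedAddCommGroup X] [NormedSpace ℂ X] (y : Fin n → X) (s : Fin n) :
    ‖∑ j, U s j • y j‖ ≤ √n * √(∑ j, ‖y j‖ ^ 2) := by
  rw [← Real.sqrt_mul (Nat.cast_nonneg n)]
  refine Real.le_sqrt_of_sq_le (le_trans ?_ (by
    simpa using sq_sum_le_card_mul_sum_sq (s := Finset.univ) (f := fun j => ‖y j‖)))
  gcongr
  refine (norm_sum_le _ _).trans (le_of_eq (Finset.sum_congr rfl fun j _ => ?_))
  rw [norm_smul, hU.norm_apply, one_mul]

/-- Only the triangle inequality and Cauchy–Schwarz enter, so X is arbitrary; this settles p = ∞. -/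
theorem IsComplexHadamard.hasHadamardType (hU : IsComplexHadamard U) (X : Type*)
    [NormedAddCommGroup X] [NormedSpace ℂ X] : HasHadamardType U (√n) X := fun y => by
  refine (Finset.prod_le_prod (fun _ _ => norm_nonneg _)
    fun s _ => hU.norm_sum_smul_le y s).trans ?_
  simp

/-- Two of the r powers are summed by the identity `sum_sq`; the other r - 2 are bounded by the
uniform estimate. -/
theorem IsComplexHadamard.sum_rpow_le (hU : IsComplexHadamard U) {r : ℝ} (hr : 2 ≤ r)
    (c : Fin n → ℂ) : ∑ s, ‖∑ j, U s j * c j‖ ^ r ≤ (n * ∑ j, ‖c j‖ ^ 2) ^ (r / 2) := by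
  set S := n * ∑ j, ‖c j‖ ^ 2
  have hS : 0 ≤ S := by positivity
  calc ∑ s, ‖∑ j, U s j * c j‖ ^ r ≤ ∑ s, ‖∑ j, U s j * c j‖ ^ 2 * S ^ ((r - 2) / 2) := by
        refine Finset.sum_le_sum fun s _ => ?_
        have h : ‖∑ j, U s j * c j‖ ≤ S ^ (1 / 2 : ℝ) := by
          rw [← Real.sqrt_eq_rpow, Real.sqrt_mul (Nat.cast_nonneg n)]
          exact hU.norm_sum_smul_le c s
        rw [show r = (2 : ℕ) + (r - 2) by push_cast; ring,
          Real.rpow_add_of_nonneg (norm_nonneg _) (by positivity) (by linarith), Real.rpow_natCast]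
        gcongr
        refine (Real.rpow_le_rpow (norm_nonneg _) h (by linarith)).trans (le_of_eq ?_)
        rw [← Real.rpow_mul hS]; congr 1; push_cast; ring
    _ = S ^ (r / 2) := by
        rw [← Finset.sum_mul, hU.sum_sq]
        change S * _ = _
        nth_rw 1 [← Real.rpow_one S]
        rw [← Real.rpow_add_of_nonneg hS zero_le_one (by linarith)]
        congr 1; ring

theorem IsComplexHadamard.sum_enorm_rpow_le (hU : IsComplexHadamard U) {r : ℝ} (hr : 2 ≤ r)
    (c : Fin n → ℂ) :
    ∑ s, ‖∑ j, U s j * c j‖ₑ ^ r ≤ (n : ℝ≥0∞) ^ (r / 2) * ‖∑ j, ‖c j‖ ^ 2‖ₑ ^ (r / 2) := by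
  have hr0 : 0 ≤ r := by linarith
  have h := ENNReal.ofReal_le_ofReal (hU.sum_rpow_le hr c)
  rw [ENNReal.ofReal_sum_of_nonneg (fun _ _ => by positivity),
    ← ENNReal.ofReal_rpow_of_nonneg (by positivity) (by positivity),
    ENNReal.ofReal_mul (by positivity), ENNReal.ofReal_natCast,
    ENNReal.mul_rpow_of_nonneg _ _ (by positivity)] at h
  simp_rw [← ENNReal.ofReal_rpow_of_nonneg (norm_nonneg _) hr0, ofReal_norm] at h
  rwa [Real.enorm_of_nonneg (by positivity)]

/-- The pointwise inequality is integrated, and Minkowski's inequality is applied to the functions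
|fⱼ|² in L_{r/2}, where r/2 ≥ 1. -/
theorem IsComplexHadamard.sum_lintegral_le (hU : IsComplexHadamard U) {r : ℝ} (hr : 2 ≤ r)
    {Ω : Type*} [MeasurableSpace Ω] {μ : Measure Ω} {f : Fin n → Ω → ℂ}
    (hf : ∀ j, AEStronglyMeasurable (f j) μ) :
    ∑ s, ∫⁻ t, ‖∑ j, U s j * f j t‖ₑ ^ r ∂μ ≤
      (n * ∑ j, (∫⁻ t, ‖f j t‖ₑ ^ r ∂μ) ^ (2 / r)) ^ (r / 2) := by
  have hr0 : 0 < r := by linarith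
  have hq : 0 < r / 2 := by linarith
  have hg : ∀ j, AEStronglyMeasurable (fun t => ‖f j t‖ ^ 2) μ := fun j => (hf j).norm.pow 2
  have hmink := eLpNorm_sum_le (p := ENNReal.ofReal (r / 2)) (s := Finset.univ) (fun j _ => hg j)
    (by rw [ENNReal.one_le_ofReal]; linarith)
  have hnorm : ∀ g : Ω → ℝ, eLpNorm g (ENNReal.ofReal (r / 2)) μ =
      (∫⁻ t, ‖g t‖ₑ ^ (r / 2) ∂μ) ^ (2 / r) := fun g => by
    rw [eLpNorm_eq_lintegral_rpow_enorm_toReal (by simpa using hr0) ENNReal.ofReal_ne_top,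
      ENNReal.toReal_ofReal hq.le, one_div_div]
  have hsq : ∀ z : ℂ, ‖‖z‖ ^ 2‖ₑ ^ (r / 2) = ‖z‖ₑ ^ r := fun z => by
    rw [enorm_pow, enorm_norm, ← ENNReal.rpow_natCast, ← ENNReal.rpow_mul]
    congr 1; push_cast; ring
  rw [hnorm] at hmink
  simp_rw [hnorm, hsq, Finset.sum_apply] at hmink
  have hpow := ENNReal.rpow_le_rpow hmink hq.le
  rw [← ENNReal.rpow_mul, show 2 / r * (r / 2) = 1 by field_simp, ENNReal.rpow_one] at hpow
  rw [ENNReal.mul_rpow_of_nonneg _ _ hq.le]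
  refine le_trans ?_ (mul_le_mul_right hpow _)
  rw [← lintegral_const_mul' _ _ (ENNReal.rpow_ne_top_of_nonneg hq.le (ENNReal.natCast_ne_top n)),
    ← lintegral_finsetSum']
  · exact lintegral_mono fun t => hU.sum_enorm_rpow_le hr fun j => f j t
  · intro s _
    refine AEMeasurable.pow_const ?_ r
    refine (AEStronglyMeasurable.enorm ?_)
    exact Finset.aestronglyMeasurable_fun_sum _ fun j _ => (hf j).const_mul _

/-- AM-GM for the r-th powers of the norms: the factor 1/n of the mean improves √n to n^(1/2 - 1/r).
-/
theorem IsComplexHadamard.hasHadamardType_of_sum_rpow (hn : n ≠ 0) {X : Type*}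
    [NormedAddCommGroup X] [NormedSpace ℂ X] {r : ℝ} (hr : 0 < r)
    (h : ∀ y : Fin n → X, ∑ s, ‖∑ j, U s j • y j‖ ^ r ≤ (n * ∑ j, ‖y j‖ ^ 2) ^ (r / 2)) :
    HasHadamardType U ((n : ℝ) ^ (1 / 2 - 1 / r)) X := fun y => by
  have hn0 : (0 : ℝ) < n := by exact_mod_cast Nat.pos_of_ne_zero hn
  set N : Fin n → ℝ := fun s => ‖∑ j, U s j • y j‖
  have hN : ∀ s, 0 ≤ N s := fun s => norm_nonneg _
  set S := ∑ j, ‖y j‖ ^ 2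
  have hS : 0 ≤ S := by positivity
  have h1 := Real.geom_mean_le_arith_mean_weighted Finset.univ (fun _ : Fin n => (n : ℝ)⁻¹)
    (fun s => N s ^ r) (fun _ _ => by positivity) (by simp [hn]) (fun s _ => by positivity)
  rw [← Finset.mul_sum] at h1
  have h2 := h1.trans (mul_le_mul_of_nonneg_left (h y) (by positivity))
  have h3 : ∏ s, (N s ^ r) ^ (n : ℝ)⁻¹ = (∏ s, N s) ^ (r / n) := by
    rw [← Real.finsetProd_rpow _ _ fun s _ => hN s]
    exact Finset.prod_congr rfl fun s _ => by rw [← Real.rpow_mul (hN s), div_eq_mul_inv]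
  have h4 : (n : ℝ)⁻¹ * (n * S) ^ (r / 2) =
      (((n : ℝ) ^ (1 / 2 - 1 / r) * √S) ^ n) ^ (r / n) := by
    rw [← Real.rpow_natCast_mul (by positivity), mul_div_cancel₀ _ hn0.ne',
      Real.mul_rpow (by positivity) (by positivity), Real.mul_rpow (by positivity) (by positivity),
      Real.sqrt_eq_rpow, ← Real.rpow_mul hS, ← Real.rpow_mul hn0.le, ← mul_assoc,
      ← Real.rpow_neg_one, ← Real.rpow_add hn0]
    congr 2
    · field_simp; ring
    · ring
  rw [h3, h4] at h2
  exact (Real.rpow_le_rpow_iff (Finset.prod_nonneg fun s _ => hN s) (by positivity)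
    (by positivity)).1 h2

/-- Here c x is a function representing x, which treats L_p and, through counting measure, ℓ_p^N
together. -/
theorem IsComplexHadamard.hasHadamardType_of_enorm_rpow (hU : IsComplexHadamard U) (hn : n ≠ 0)
    {X : Type*} [NormedAddCommGroup X] [NormedSpace ℂ X] {r : ℝ} (hr : 2 ≤ r) {Ω : Type*}
    [MeasurableSpace Ω] {μ : Measure Ω} {c : X → Ω → ℂ}
    (hc : ∀ x, AEStronglyMeasurable (c x) μ) (hnorm : ∀ x, ‖x‖ₑ ^ r = ∫⁻ t, ‖c x t‖ₑ ^ r ∂μ)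
    (hadd : ∀ (y : Fin n → X) s, c (∑ j, U s j • y j) =ᵐ[μ] fun t => ∑ j, U s j * c (y j) t) :
    HasHadamardType U ((n : ℝ) ^ (1 / 2 - 1 / r)) X := by
  have hr0 : 0 < r := by linarith
  refine hasHadamardType_of_sum_rpow hn hr0 fun y => ?_
  have h := hU.sum_lintegral_le hr fun j => hc (y j)
  have h1 : ∀ s, ∫⁻ t, ‖∑ j, U s j * c (y j) t‖ₑ ^ r ∂μ = ‖∑ j, U s j • y j‖ₑ ^ r := fun s => by
    rw [hnorm]
    refine lintegral_congr_ae ?_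
    filter_upwards [hadd y s] with t ht
    rw [ht]
  have h2 : ∀ j, (∫⁻ t, ‖c (y j) t‖ₑ ^ r ∂μ) ^ (2 / r) = ENNReal.ofReal (‖y j‖ ^ 2) := fun j => by
    rw [← hnorm, ← ENNReal.rpow_mul, mul_div_cancel₀ _ hr0.ne', ← ofReal_norm,
      ENNReal.ofReal_rpow_of_nonneg (norm_nonneg _) zero_le_two]
    norm_num
  simp_rw [h1, h2, ← ofReal_norm, ENNReal.ofReal_rpow_of_nonneg (norm_nonneg _) hr0.le] at h
  rw [← ENNReal.ofReal_sum_of_nonneg (fun _ _ => by positivity),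
    ← ENNReal.ofReal_sum_of_nonneg (fun _ _ => by positivity), ← ENNReal.ofReal_natCast,
    ← ENNReal.ofReal_mul (by positivity),
    ENNReal.ofReal_rpow_of_nonneg (by positivity) (by positivity)] at h
  exact (ENNReal.ofReal_le_ofReal_iff (by positivity)).1 h

theorem IsComplexHadamard.hasHadamardType_Lp (hU : IsComplexHadamard U) (hn : n ≠ 0)
    {p : ℝ≥0∞} [Fact (1 ≤ p)] (hp : 2 ≤ p) {Ω : Type*} [MeasurableSpace Ω] (μ : Measure Ω) :
    HasHadamardType U ((n : ℝ) ^ (1 / 2 - (1 / p).toReal)) (Lp ℂ p μ) := by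
  rcases eq_or_ne p ∞ with rfl | hp'
  · simpa [Real.sqrt_eq_rpow] using hU.hasHadamardType (Lp ℂ ∞ μ)
  have hr : (2 : ℝ) ≤ p.toReal := by simpa using ENNReal.toReal_mono hp' hp
  have hr0 : 0 < p.toReal := by linarith
  have he : (1 / p).toReal = 1 / p.toReal := by simp
  rw [he]
  refine hU.hasHadamardType_of_enorm_rpow hn hr (c := fun x => x) (μ := μ)
    (fun x => Lp.aestronglyMeasurable x) (fun x => ?_) fun y s => ?_
  · rw [Lp.enorm_def, eLpNorm_eq_lintegral_rpow_enorm_toReal (zero_lt_two.trans_le hp).ne' hp',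
      ← ENNReal.rpow_mul, one_div_mul_cancel hr0.ne', ENNReal.rpow_one]
  · have h1 : ∀ j, ∀ᵐ t ∂μ, (U s j • y j : Lp ℂ p μ) t = U s j * y j t := fun j => by
      filter_upwards [Lp.coeFn_smul (U s j) (y j)] with t ht
      rw [ht]; rfl
    filter_upwards [Lp.coeFn_finsetSum Finset.univ fun j => U s j • y j, ae_all_iff.2 h1]
      with t ht h2
    rw [ht, Finset.sum_apply]
    exact Finset.sum_congr rfl fun j _ => h2 j

theorem IsComplexHadamard.hasHadamardType_PiLp (hU : IsComplexHadamard U) (hn : n ≠ 0)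
    {p : ℝ≥0∞} [Fact (1 ≤ p)] (hp : 2 ≤ p) (N : ℕ) :
    HasHadamardType U ((n : ℝ) ^ (1 / 2 - (1 / p).toReal)) (PiLp p (fun _ : Fin N => ℂ)) := by
  rcases eq_or_ne p ∞ with rfl | hp'
  · simpa [Real.sqrt_eq_rpow] using hU.hasHadamardType (PiLp ∞ (fun _ : Fin N => ℂ))
  have hr : (2 : ℝ) ≤ p.toReal := by simpa using ENNReal.toReal_mono hp' hp
  have hr0 : 0 < p.toReal := by linarith
  have he : (1 / p).toReal = 1 / p.toReal := by simp
  rw [he]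
  refine hU.hasHadamardType_of_enorm_rpow hn hr (c := fun x i => x i) (μ := Measure.count)
    (fun x => .of_discrete) (fun x => ?_) fun y s => ?_
  · rw [lintegral_count, tsum_fintype]
    simp_rw [← ofReal_norm, ENNReal.ofReal_rpow_of_nonneg (norm_nonneg _) hr0.le]
    rw [← ENNReal.ofReal_sum_of_nonneg (fun _ _ => by positivity), PiLp.norm_eq_sum hr0,
      ← Real.rpow_mul (Finset.sum_nonneg fun _ _ => by positivity), one_div_mul_cancel hr0.ne',
      Real.rpow_one]
  · exact .of_forall fun t => by simp

end HadamardType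

/-! ### The upper bound on ℓ_p^N -/

theorem PiLp.norm_mono {ι : Type*} [Fintype ι] {p : ℝ≥0∞} [Fact (1 ≤ p)] {E F : ι → Type*}
    [∀ i, NormedAddCommGroup (E i)] [∀ i, NormedAddCommGroup (F i)] {x : PiLp p E} {y : PiLp p F}
    (h : ∀ i, ‖x i‖ ≤ ‖y i‖) : ‖x‖ ≤ ‖y‖ := by
  rcases eq_or_ne p ∞ with rfl | hp
  · rw [PiLp.norm_eq_ciSup, PiLp.norm_eq_ciSup]
    exact ciSup_mono (Set.finite_range _).bddAbove h
  · have hr : 0 < p.toReal := ENNReal.toReal_pos (zero_lt_one.trans_le (Fact.out : 1 ≤ p)).ne' hp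
    rw [PiLp.norm_eq_sum hr, PiLp.norm_eq_sum hr]
    gcongr with i
    exact h i

theorem PiLp.norm_toLp_extend {ι κ : Type*} [Fintype ι] [Fintype κ] {p : ℝ≥0∞} [Fact (1 ≤ p)]
    {e : ι → κ} (he : Function.Injective e) (c : ι → ℂ) :
    ‖(WithLp.toLp p (Function.extend e c 0) : PiLp p (fun _ : κ => ℂ))‖ =
      ‖(WithLp.toLp p c : PiLp p (fun _ : ι => ℂ))‖ := by
  have hnot : ∀ j ∉ Set.range e, Function.extend e c 0 j = 0 := fun j hj => by
    rw [Function.extend_apply' _ _ _ hj]; rfl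
  rcases eq_or_ne p ∞ with rfl | hp
  · rw [PiLp.norm_eq_ciSup, PiLp.norm_eq_ciSup]
    have h0 : 0 ≤ ⨆ i, ‖c i‖ := Real.iSup_nonneg fun _ => norm_nonneg _
    refine le_antisymm (Real.iSup_le (fun j => ?_) h0)
      (Real.iSup_le (fun i => ?_) (Real.iSup_nonneg fun _ => norm_nonneg _))
    · by_cases hj : j ∈ Set.range e
      · obtain ⟨i, rfl⟩ := hj
        simp only [he.extend_apply]
        exact le_ciSup (f := fun i => ‖c i‖) (Set.finite_range _).bddAbove i
      · simpa [hnot j hj] using h0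
    · refine le_trans (le_of_eq ?_) (le_ciSup (Set.finite_range _).bddAbove (e i))
      simp [he.extend_apply]
  · have hr : 0 < p.toReal := ENNReal.toReal_pos (zero_lt_one.trans_le (Fact.out : 1 ≤ p)).ne' hp
    rw [PiLp.norm_eq_sum hr, PiLp.norm_eq_sum hr]
    congr 1
    refine (Fintype.sum_of_injective e he _ _ (fun j hj => ?_) fun i => ?_).symm
    · simp [hnot j hj, hr.ne']
    · simp [he.extend_apply]

theorem optimalConst_PiLp_le {n N : ℕ} (hn : n ≠ 0) (hN : n ≤ N) (k : Fin n → ℕ) {p : ℝ≥0∞}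
    [Fact (1 ≤ p)] (hp : 2 ≤ p) :
    optimalConst (PiLp p (fun _ : Fin N => ℂ)) k ≤ hilbertConst k := by
  have : Nonempty (Fin N) := ⟨⟨0, by omega⟩⟩
  have he : Function.Injective (Fin.castLE hN) := Fin.castLE_injective hN
  refine optimalConst_le_hilbertConst_of_retract hn k hp
    (fun i => PiLp.proj p (fun _ : Fin N => ℂ) (Fin.castLE hN i)) (fun x => ?_)
    (fun c => WithLp.toLp p (Function.extend (Fin.castLE hN) c 0)) (fun c => ?_) fun c i => ?_
  · rw [← PiLp.norm_toLp_extend he]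
    refine PiLp.norm_mono fun j => ?_
    by_cases hj : j ∈ Set.range (Fin.castLE hN)
    · obtain ⟨i, rfl⟩ := hj
      simp [he.extend_apply]
    · simp [Function.extend_apply' _ _ _ hj]
  · exact (PiLp.norm_toLp_extend he _).le
  · simp [he.extend_apply]

/-! ### The upper bound on L_p of a decomposed measure space -/

section Lp

variable {Ω : Type*} [MeasurableSpace Ω] {μ : Measure Ω} {n : ℕ} {A : Fin n → Set Ω}
  {p : ℝ≥0∞} [Fact (1 ≤ p)]

theorem norm_LpToLpRestrictCLM (s : Set Ω) (f : Lp ℂ p μ) :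
    ‖LpToLpRestrictCLM Ω ℂ ℂ μ p s f‖ = (eLpNorm f p (μ.restrict s)).toReal := by
  rw [Lp.norm_def, eLpNorm_congr_ae (LpToLpRestrictCLM_coeFn ℂ s f)]

theorem IsDecomposition.ae_of_forall_restrict (hA : IsDecomposition μ A) {q : Ω → Prop}
    (h : ∀ i, ∀ᵐ t ∂μ.restrict (A i), q t) : ∀ᵐ t ∂μ, q t := by
  rw [← Measure.restrict_univ (μ := μ), ← hA.cover, ae_restrict_iUnion_iff]
  exact h

theorem IsDecomposition.lintegral_eq_sum (hA : IsDecomposition μ A) (g : Ω → ℝ≥0∞) :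
    ∫⁻ t, g t ∂μ = ∑ i, ∫⁻ t in A i, g t ∂μ := by
  conv_lhs => rw [← Measure.restrict_univ (μ := μ), ← hA.cover]
  rw [lintegral_iUnion₀ (fun i => (hA.measurable i).nullMeasurableSet)
    (fun i j hij => hA.inter_null i j hij), tsum_fintype]

/-- The pieces overlap only in null sets, so L_p(Ω) is the ℓ_p-sum of the spaces L_p(Aᵢ). -/
theorem IsDecomposition.norm_eq (hA : IsDecomposition μ A) (f : Lp ℂ p μ) :
    ‖f‖ = ‖(WithLp.toLp p (fun i => LpToLpRestrictCLM Ω ℂ ℂ μ p (A i) f) :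
      PiLp p (fun i => Lp ℂ p (μ.restrict (A i))))‖ := by
  have htop : ∀ i, eLpNorm f p (μ.restrict (A i)) ≠ ∞ := fun i =>
    ((Lp.memLp f).restrict (A i)).eLpNorm_ne_top
  rcases eq_or_ne p ∞ with rfl | hp
  · rw [PiLp.norm_eq_ciSup]
    simp_rw [norm_LpToLpRestrictCLM]
    rw [Lp.norm_def]
    refine le_antisymm ?_ (Real.iSup_le (fun i => ?_) ENNReal.toReal_nonneg)
    · refine ENNReal.toReal_le_of_le_ofReal (Real.iSup_nonneg fun _ => ENNReal.toReal_nonneg) ?_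
      rw [eLpNorm_exponent_top]
      refine eLpNormEssSup_le_of_ae_enorm_bound (hA.ae_of_forall_restrict fun i => ?_)
      filter_upwards [enorm_ae_le_eLpNormEssSup f (μ.restrict (A i))] with t ht
      refine ht.trans ?_
      rw [← eLpNorm_exponent_top, ← ENNReal.ofReal_toReal (htop i)]
      exact ENNReal.ofReal_le_ofReal
        (le_ciSup (f := fun i => (eLpNorm f ∞ (μ.restrict (A i))).toReal)
          (Set.finite_range _).bddAbove i)
    · exact ENNReal.toReal_mono (Lp.memLp f).eLpNorm_ne_top (eLpNorm_restrict_le _ _ _ _)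
  · have hp0 : p ≠ 0 := (zero_lt_one.trans_le (Fact.out : 1 ≤ p)).ne'
    have hr : 0 < p.toReal := ENNReal.toReal_pos hp0 hp
    have key : ∀ ν : Measure Ω, (eLpNorm f p ν).toReal ^ p.toReal =
        (∫⁻ t, ‖f t‖ₑ ^ p.toReal ∂ν).toReal := fun ν => by
      rw [eLpNorm_eq_lintegral_rpow_enorm_toReal hp0 hp, ENNReal.toReal_rpow, ← ENNReal.rpow_mul,
        one_div_mul_cancel hr.ne', ENNReal.rpow_one]
    have hfin : ∀ i, ∫⁻ t in A i, ‖f t‖ₑ ^ p.toReal ∂μ ≠ ∞ := fun i =>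
      (lintegral_rpow_enorm_lt_top_of_eLpNorm_lt_top hp0 hp (htop i).lt_top).ne
    have hsum : ‖f‖ ^ p.toReal = ∑ i, ‖LpToLpRestrictCLM Ω ℂ ℂ μ p (A i) f‖ ^ p.toReal := by
      simp_rw [norm_LpToLpRestrictCLM, Lp.norm_def, key]
      rw [← ENNReal.toReal_sum fun i _ => hfin i]
      exact congrArg _ (hA.lintegral_eq_sum _)
    rw [PiLp.norm_eq_sum hr, ← hsum, ← Real.rpow_mul (norm_nonneg _), mul_one_div_cancel hr.ne',
      Real.rpow_one]

theorem IsDecomposition.exists_restrict_ne_zero (hA : IsDecomposition μ A)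
    (hfin : p ≠ ∞ → HasFiniteParts μ A) (i : Fin n) :
    ∃ f : Lp ℂ p μ, LpToLpRestrictCLM Ω ℂ ℂ μ p (A i) f ≠ 0 ∧
      ∀ j ≠ i, LpToLpRestrictCLM Ω ℂ ℂ μ p (A j) f = 0 := by
  obtain ⟨B, hBA, hB, hpos, hmem⟩ : ∃ B ⊆ A i, MeasurableSet B ∧ 0 < μ B ∧
      MemLp (B.indicator fun _ => (1 : ℂ)) p μ := by
    rcases eq_or_ne p ∞ with rfl | hp
    -- At p = ∞ the indicator of A i itself is admissible, whatever its measure.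
    · exact ⟨A i, subset_rfl, hA.measurable i, hA.pos i,
        (memLp_top_const 1).indicator (hA.measurable i)⟩
    · obtain ⟨B, hBA, hB, hpos, hlt⟩ := hfin hp i
      exact ⟨B, hBA, hB, hpos, memLp_indicator_const p hB 1 (Or.inr hlt.ne)⟩
  have hcoe : ∀ j, LpToLpRestrictCLM Ω ℂ ℂ μ p (A j) (hmem.toLp _) =ᵐ[μ.restrict (A j)]
      B.indicator fun _ => (1 : ℂ) := fun j =>
    (LpToLpRestrictCLM_coeFn ℂ (A j) _).trans (ae_restrict_of_ae hmem.coeFn_toLp)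
  refine ⟨hmem.toLp _, fun h => ?_, fun j hj => ?_⟩
  · have h1 : ∀ᵐ t ∂μ.restrict (A i), t ∉ B := by
      have h2 := (Lp.eq_zero_iff_ae_eq_zero.1 h)
      filter_upwards [h2, hcoe i] with t ht1 ht2 htB
      rw [ht1] at ht2
      simp [htB] at ht2
    have h3 : μ.restrict (A i) B = 0 := by
      rw [ae_iff] at h1
      simpa using h1
    rw [Measure.restrict_apply hB, Set.inter_eq_left.2 hBA] at h3
    exact hpos.ne' h3
  · rw [Lp.eq_zero_iff_ae_eq_zero]
    have h1 : ∀ᵐ t ∂μ.restrict (A j), t ∉ B := by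
      rw [ae_iff]
      simp only [not_not, Set.ofPred_mem_eq]
      rw [Measure.restrict_apply hB]
      exact measure_mono_null (Set.inter_subset_inter_left _ hBA) (hA.inter_null i j hj.symm)
    filter_upwards [hcoe j, h1] with t ht htB
    simp [ht, htB]

theorem IsDecomposition.nontrivial_Lp (hn : n ≠ 0) (hA : IsDecomposition μ A)
    (hfin : p ≠ ∞ → HasFiniteParts μ A) : Nontrivial (Lp ℂ p μ) := by
  obtain ⟨f, hf, -⟩ := hA.exists_restrict_ne_zero hfin ⟨0, Nat.pos_of_ne_zero hn⟩
  exact ⟨f, 0, fun h => hf (by rw [h, map_zero])⟩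

/-- The span of normalized functions fᵢ supported on Aᵢ is a copy of ℓ_pⁿ. Restricting to Aᵢ and
applying a functional that norms fᵢ there gives the i-th coordinate of the retraction. -/
theorem IsDecomposition.optimalConst_Lp_le (hn : n ≠ 0) (hA : IsDecomposition μ A)
    (hfin : p ≠ ∞ → HasFiniteParts μ A) (k : Fin n → ℕ) (hp : 2 ≤ p) :
    optimalConst (Lp ℂ p μ) k ≤ hilbertConst k := by
  have := hA.nontrivial_Lp hn hfin
  let R : ∀ i, Lp ℂ p μ →L[ℂ] Lp ℂ p (μ.restrict (A i)) := fun i =>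
    LpToLpRestrictCLM Ω ℂ ℂ μ p (A i)
  have hex : ∀ i, ∃ f : Lp ℂ p μ, ‖R i f‖ = 1 ∧ ∀ j ≠ i, R j f = 0 := fun i => by
    obtain ⟨f, hf, hf0⟩ := hA.exists_restrict_ne_zero hfin i
    refine ⟨(‖R i f‖ : ℂ)⁻¹ • f, ?_, fun j hj => ?_⟩
    · have : ‖R i f‖ ≠ 0 := norm_ne_zero_iff.2 hf
      rw [map_smul, norm_smul]
      simp [this]
    · have : R j f = 0 := hf0 j hj
      rw [map_smul, this, smul_zero]
  choose f hf1 hf0 using hex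
  have hdual : ∀ i, ∃ g : StrongDual ℂ (Lp ℂ p (μ.restrict (A i))), ‖g‖ = 1 ∧ g (R i (f i)) = 1 :=
    fun i => by
      have hne : ‖R i (f i)‖ ≠ 0 := by simp [hf1 i]
      obtain ⟨g, hg, hg1⟩ := exists_dual_vector ℂ (R i (f i)) hne
      exact ⟨g, hg, by rw [hg1, hf1]; simp⟩
  choose g hg hg1 using hdual
  have hR : ∀ (c : Fin n → ℂ) i, R i (∑ j, c j • f j) = c i • R i (f i) := fun c i => by
    rw [map_sum, Finset.sum_eq_single i]
    · rw [map_smul]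
    · intro j _ hj
      rw [map_smul, hf0 j i hj.symm, smul_zero]
    · simp
  refine optimalConst_le_hilbertConst_of_retract hn k hp (fun i => (g i).comp (R i)) (fun x => ?_)
    (fun c => ∑ j, c j • f j) (fun c => ?_) fun c i => ?_
  · rw [hA.norm_eq]
    refine PiLp.norm_mono fun i => ?_
    simpa [hg, R] using (g i).le_opNorm (R i x)
  · rw [hA.norm_eq]
    refine PiLp.norm_mono fun i => le_of_eq ?_
    change ‖R i (∑ j, c j • f j)‖ = _
    rw [hR, norm_smul, hf1, mul_one]
  · change g i (R i (∑ j, c j • f j)) = c i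
    rw [hR, map_smul, hg1]
    simp

end Lp

/-! ### Comparison with Hilbert spaces -/

theorem rpow_mul_hilbertConst_le_optimalConst {n : ℕ} (hn : n ≠ 0) {U : Fin n → Fin n → ℂ}
    (hU : IsComplexHadamard U) {e : ℝ} {X : Type*} [NormedAddCommGroup X] [NormedSpace ℂ X]
    [Nontrivial X] (h : HasHadamardType U ((n : ℝ) ^ (1 / 2 - e)) X) (k : Fin n → ℕ) :
    ((n : ℝ) ^ (∑ i, k i)) ^ (e - 1 / 2 : ℝ) * hilbertConst k ≤ optimalConst X k := by
  have hn0 : (0 : ℝ) < n := by exact_mod_cast Nat.pos_of_ne_zero hn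
  refine le_trans (le_of_eq ?_) (h.le_optimalConst hn hU (by positivity) k)
  congr 1
  rw [← Real.rpow_natCast, ← Real.rpow_natCast, ← Real.rpow_mul hn0.le, ← Real.rpow_mul hn0.le,
    ← Real.rpow_neg hn0.le]
  congr 1
  ring

/-- At exponent 2 the Hadamard constant is n⁰ = 1, so the lower bound meets the upper one. -/
theorem optimalConst_eq_hilbertConst {n : ℕ} (hn : n ≠ 0) {U : Fin n → Fin n → ℂ}
    (hU : IsComplexHadamard U) {X : Type*} [NormedAddCommGroup X] [NormedSpace ℂ X]
    [Nontrivial X] (h : HasHadamardType U ((n : ℝ) ^ (1 / 2 - (1 / (2 : ℝ≥0∞)).toReal)) X)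
    {k : Fin n → ℕ} (hle : optimalConst X k ≤ hilbertConst k) :
    optimalConst X k = hilbertConst k := by
  refine le_antisymm hle ?_
  simpa using rpow_mul_hilbertConst_le_optimalConst hn hU h k

theorem mainTheorem4 (n : ℕ) (hn : 1 ≤ n) (k : Fin n → ℕ) (p : ℝ≥0∞) [Fact (1 ≤ p)]
    (hp : 2 ≤ p) :
    (∀ N : ℕ, n ≤ N →
      optimalConst (PiLp 2 (fun _ : Fin N => ℂ)) k ≥ optimalConst (PiLp p (fun _ : Fin N => ℂ)) k ∧
      optimalConst (PiLp p (fun _ : Fin N => ℂ)) k ≥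
        ((n : ℝ) ^ (∑ i, k i)) ^ ((1 / p).toReal - 1 / 2 : ℝ) *
          optimalConst (PiLp 2 (fun _ : Fin N => ℂ)) k) ∧
    (∀ (Ω : Type*) [MeasurableSpace Ω] (μ : Measure Ω) (A : Fin n → Set Ω),
      IsDecomposition μ A →
      -- comparison with the Hilbert spaces `ℓ₂ᴺ`
      ((p ≠ ∞ → HasFiniteParts μ A) → ∀ N : ℕ, n ≤ N →
        optimalConst (PiLp 2 (fun _ : Fin N => ℂ)) k ≥ optimalConst (Lp ℂ p μ) k ∧
        optimalConst (Lp ℂ p μ) k ≥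
          ((n : ℝ) ^ (∑ i, k i)) ^ ((1 / p).toReal - 1 / 2 : ℝ) *
            optimalConst (PiLp 2 (fun _ : Fin N => ℂ)) k) ∧
      -- comparison with the Hilbert space `L₂(Ω, μ)`
      (HasFiniteParts μ A →
        optimalConst (Lp ℂ 2 μ) k ≥ optimalConst (Lp ℂ p μ) k ∧
        optimalConst (Lp ℂ p μ) k ≥
          ((n : ℝ) ^ (∑ i, k i)) ^ ((1 / p).toReal - 1 / 2 : ℝ) *
            optimalConst (Lp ℂ 2 μ) k)) := by
  have hn0 : n ≠ 0 := by omega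
  obtain ⟨U, hU⟩ := exists_isComplexHadamard hn0
  have h2 : ∀ N, n ≤ N → optimalConst (PiLp 2 (fun _ : Fin N => ℂ)) k = hilbertConst k :=
    fun N hN => by
      have : Nonempty (Fin N) := ⟨⟨0, by omega⟩⟩
      exact optimalConst_eq_hilbertConst hn0 hU (hU.hasHadamardType_PiLp hn0 le_rfl N)
        (optimalConst_PiLp_le hn0 hN k le_rfl)
  refine ⟨fun N hN => ?_, fun Ω _ μ A hA => ?_⟩
  · have : Nonempty (Fin N) := ⟨⟨0, by omega⟩⟩
    rw [h2 N hN]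
    exact ⟨optimalConst_PiLp_le hn0 hN k hp,
      rpow_mul_hilbertConst_le_optimalConst hn0 hU (hU.hasHadamardType_PiLp hn0 hp N) k⟩
  · have hLp : (p ≠ ∞ → HasFiniteParts μ A) → optimalConst (Lp ℂ p μ) k ≤ hilbertConst k ∧
        ((n : ℝ) ^ (∑ i, k i)) ^ ((1 / p).toReal - 1 / 2 : ℝ) * hilbertConst k ≤
          optimalConst (Lp ℂ p μ) k := fun hfin => by
      have := hA.nontrivial_Lp hn0 hfin
      exact ⟨hA.optimalConst_Lp_le hn0 hfin k hp,
        rpow_mul_hilbertConst_le_optimalConst hn0 hU (hU.hasHadamardType_Lp hn0 hp μ) k⟩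
    refine ⟨fun hfin N hN => ?_, fun hfin => ?_⟩
    · rw [h2 N hN]
      exact hLp hfin
    · have := hA.nontrivial_Lp (p := 2) hn0 fun _ => hfin
      rw [optimalConst_eq_hilbertConst hn0 hU (hU.hasHadamardType_Lp hn0 le_rfl μ)
        (hA.optimalConst_Lp_le hn0 (fun _ => hfin) k le_rfl)]
      exact hLp fun _ => hfin
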